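/- Let $\mathcal M$ be a preadditive braided monoidal category which has equalizers and denumerable coproducts, and whose tensor product is additive in each variable and preserves equalizers and denumerable coproducts in each variable. Let $\Omega:\mathrm{Alg}(\mathcal M)\to\mathcal M$ and $\mho:\mathrm{Bialg}(\mathcal M)\to\mathrm{Alg}(\mathcal M)$ be the forgetful functors from monoids and from bimonoids in $\mathcal M$. Let $T:\mathcal M\to\mathrm{Alg}(\mathcal M)$ be the tensor algebra functor, so that $\Omega TV=\bigoplus_{n\in\mathbb N}V^{\otimes n}$ with canonical inclusions $\alpha_nV:V^{\otimes n}\to\Omega TV$; it is left adjoint to $\Omega$ with unit $\eta V=\alpha_1V$. Let $\mathbf T:\mathcal M\to\mathrm{Bialg}(\mathcal M)$ be the tensor bialgebra functor: $\mho\mathbf T=T$, and the comultiplication and counit of $\mathbf TV$ are the algebra morphisms $TV\to TV\otimes TV$ and $TV\to\mathbf 1$ whose restrictions along $\alpha_1V$ are "$x\mapsto 1\otimes x+x\otimes 1$" (where $1\otimes x$ and $x\otimes 1$ are formed with the unit $\mathbf 1\to TV$ of the algebra) and $0$. It is left adjoint to the functor $\mathbf P:\mathrm{Bialg}(\mathcal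 M)\to\mathcal M$ of primitive elements, where $\mathbf PB$ is the equalizer of the comultiplication of $B$ and of "$x\mapsto 1\otimes x+x\otimes 1$". Let $\boldsymbol\eta:\mathrm{Id}\to\mathbf P\mathbf T$ and $\boldsymbol\epsilon:\mathbf T\mathbf P\to\mathrm{Id}$ be the unit and counit of the adjunction $(\mathbf T,\mathbf P)$. Let $\xi:\mathbf P\to\Omega\mho$ be the composite $$\mathbf P\xrightarrow{\ \eta\mathbf P\ }\Omega T\mathbf P=\Omega\mho\mathbf T\mathbf P\xrightarrow{\ \Omega\mho\boldsymbol\epsilon\ }\Omega\mho ,$$ and let $\omega:\Omega T\to\mathrm{Id}_{\mathcal M}$ be the natural transformation determined by $\omega V\circ\alpha_nV=\delta_{n,1}\mathrm{Id}_V$ for all $n\in\mathbb N$. Set $\boldsymbol\gamma:=\omega\circ\xi\mathbf T:\mathbf P\mathbf T\to\mathrm{Id}_{\mathcal M}$. Then $$\boldsymbol\gamma\circ\boldsymbol\eta=\mathrm{Id}\qquad\text{and}\qquad\boldsymbol\gamma\boldsymbol\gamma=\boldsymbol\gamma\circ\mathbf P\boldsymbol\epsilon\mathbf T ,$$ where $\boldsymbol\gamma\boldsymbol\gamma:\mathbf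 P\mathbf T\mathbf P\mathbf T\to\mathrm{Id}_{\mathcal M}$ is the horizontal composite. Hence $\mathbf T:\mathcal M\to\mathrm{Bialg}(\mathcal M)$ is heavily separable (h-separable): there is a family of maps $P_{X,Y}:\mathrm{Hom}(\mathbf TX,\mathbf TY)\to\mathrm{Hom}_{\mathcal M}(X,Y)$, natural in $X$ and $Y$, with $P_{X,Y}(\mathbf Tf)=f$ for all $f:X\to Y$ and $P_{X,Z}(g\circ f)=P_{Y,Z}(g)\circ P_{X,Y}(f)$ for all $f:\mathbf TX\to\mathbf TY$ and $g:\mathbf TY\to\mathbf TZ$. -/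

import Mathlib

open CategoryTheory CategoryTheory.Limits CategoryTheory.MonoidalCategory
open scoped MonObj ComonObj

universe v u v' u'

set_option linter.unusedSectionVars false

noncomputable section

namespace HSep

/-! ### Heavily separable functors -/

/-- A functor `F : B ⥤ A` is heavily separable if there is a family of maps
`P X Y : Hom (F X, F Y) → Hom (X, Y)`, natural in `X` and `Y`, which is a retraction of the
action of `F` on morphisms and which is compatible with composition. -/
def IsHSeparable {B : Type u} [Category.{v} B] {A : Type u'} [Category.{v'} A] (F : B ⥤ A) :
    Prop :=
  ∃ P : ∀ X Y : B, (F.obj X ⟶ F.obj Y) → (X ⟶ Y),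
    (∀ (X' X Y Y' : B) (f : X' ⟶ X) (g : F.obj X ⟶ F.obj Y) (h : Y ⟶ Y'),
      P X' Y' (F.map f ≫ g ≫ F.map h) = f ≫ P X Y g ≫ h) ∧
    (∀ (X Y : B) (f : X ⟶ Y), P X Y (F.map f) = f) ∧
    (∀ (X Y Z : B) (f : F.obj X ⟶ F.obj Y) (g : F.obj Y ⟶ F.obj Z),
      P X Z (f ≫ g) = P X Y f ≫ P Y Z g)

variable {C : Type u} [Category.{v} C] [MonoidalCategory C]

/-! ### The tensor algebra -/

/-- The iterated tensor powers `V^{⊗ n}`, with `V^{⊗ 0} = 𝟙` and `V^{⊗ (n+1)} = V^{⊗ n} ⊗ V`. -/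
@[reducible] def tpow (V : C) : ℕ → C
  | 0 => 𝟙_ C
  | n + 1 => tpow V n ⊗ V

/-- The iterated tensor powers of a morphism. -/
def tpowMap {V W : C} (f : V ⟶ W) : ∀ n : ℕ, tpow V n ⟶ tpow W n
  | 0 => 𝟙 (𝟙_ C)
  | n + 1 => tpowMap f n ⊗ₘ f

/-- The concatenation isomorphism `V^{⊗ m} ⊗ V^{⊗ n} ⟶ V^{⊗ (m + n)}`. -/
def concat (V : C) (m : ℕ) : ∀ n : ℕ, tpow V m ⊗ tpow V n ⟶ tpow V (m + n)
  | 0 => (ρ_ (tpow V m)).hom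
  | n + 1 => (α_ (tpow V m) (tpow V n) V).inv ≫ concat V m n ▷ V

/-- The iterated multiplication `A^{⊗ n} ⟶ A` of a monoid `A`. -/
def iterMul (A : C) [MonObj A] : ∀ n : ℕ, tpow A n ⟶ A
  | 0 => η[A]
  | n + 1 => iterMul A n ▷ A ≫ μ[A]

section Coproducts

variable [HasCoproductsOfShape ℕ C]

/-- The underlying object `∐ n, V^{⊗ n}` of the tensor algebra. -/
def tobj (V : C) : C := ∐ (tpow V)

/-- The canonical inclusion `V^{⊗ n} ⟶ ∐ n, V^{⊗ n}`. -/
def incl (V : C) (n : ℕ) : tpow V n ⟶ tobj V := Sigma.ι (tpow V) n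

/-- The morphism out of `∐ n, V^{⊗ n}` with given components. -/
def tdesc {V Z : C} (f : ∀ n, tpow V n ⟶ Z) : tobj V ⟶ Z := Sigma.desc f

@[simp]
lemma incl_tdesc {V Z : C} (f : ∀ n, tpow V n ⟶ Z) (n : ℕ) : incl V n ≫ tdesc f = f n := by
  exact Sigma.ι_desc f n

@[simp]
lemma incl_tdesc_assoc {V Z Z' : C} (f : ∀ n, tpow V n ⟶ Z) (n : ℕ) (h : Z ⟶ Z') :
    incl V n ≫ tdesc f ≫ h = f n ≫ h := by
  rw [← Category.assoc, incl_tdesc]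

lemma tobj_hom_ext {V Z : C} {f g : tobj V ⟶ Z} (h : ∀ n, incl V n ≫ f = incl V n ≫ g) :
    f = g :=
  Sigma.hom_ext _ _ h

/-- The inclusion of `V` into the tensor algebra. -/
def gen (V : C) : V ⟶ tobj V := (λ_ V).inv ≫ incl V 1

section Multiplication

variable [∀ X : C, PreservesColimitsOfShape (Discrete ℕ) (tensorLeft X)]
  [∀ X : C, PreservesColimitsOfShape (Discrete ℕ) (tensorRight X)]

lemma whiskerRight_hom_ext {V W Z : C} {f g : tobj V ⊗ W ⟶ Z}
    (h : ∀ n, incl V n ▷ W ≫ f = incl V n ▷ W ≫ g) : f = g := by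
  refine (isColimitOfPreserves (tensorRight W) (colimit.isColimit (Discrete.functor (tpow V)))).hom_ext ?_
  rintro ⟨n⟩
  exact h n

lemma whiskerLeft_hom_ext {V W Z : C} {f g : W ⊗ tobj V ⟶ Z}
    (h : ∀ n, W ◁ incl V n ≫ f = W ◁ incl V n ≫ g) : f = g := by
  refine (isColimitOfPreserves (tensorLeft W) (colimit.isColimit (Discrete.functor (tpow V)))).hom_ext ?_
  rintro ⟨n⟩
  exact h n

/-- The morphism out of `G (∐ n, V^{⊗ n})` with given components, for a functor `G` preserving
denumerable coproducts. -/
def mapDesc (G : C ⥤ C) [PreservesColimitsOfShape (Discrete ℕ) G] {V Z : C}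
    (f : ∀ n, G.obj (tpow V n) ⟶ Z) : G.obj (tobj V) ⟶ Z :=
  (PreservesCoproduct.iso G (tpow V)).hom ≫ Sigma.desc f

lemma map_incl_mapDesc (G : C ⥤ C) [PreservesColimitsOfShape (Discrete ℕ) G] {V Z : C}
    (f : ∀ n, G.obj (tpow V n) ⟶ Z) (n : ℕ) : G.map (incl V n) ≫ mapDesc G f = f n := by
  have h : G.map (incl V n) = Sigma.ι (fun n => G.obj (tpow V n)) n ≫
      (PreservesCoproduct.iso G (tpow V)).inv :=
    (ι_comp_sigmaComparison G (tpow V) n).symm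
  have h' : G.map (incl V n) ≫ (PreservesCoproduct.iso G (tpow V)).hom =
      Sigma.ι (fun n => G.obj (tpow V n)) n := (Iso.eq_comp_inv _).1 h
  exact ((Category.assoc _ _ _).symm.trans (congrArg (fun k => k ≫ Sigma.desc f) h')).trans
    (Sigma.ι_desc f n)

/-- The right multiplication `(∐ n, V^{⊗ n}) ⊗ V ⟶ ∐ n, V^{⊗ n}` by the generators. -/
def mulGen (V : C) : tobj V ⊗ V ⟶ tobj V :=
  mapDesc (tensorRight V) fun n => incl V (n + 1)

@[simp]
lemma incl_mulGen (V : C) (n : ℕ) : incl V n ▷ V ≫ mulGen V = incl V (n + 1) :=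
  map_incl_mapDesc (tensorRight V) (fun n => incl V (n + 1)) n

lemma incl_mulGen_assoc (V : C) (n : ℕ) {Z : C} (h : tobj V ⟶ Z) :
    incl V n ▷ V ≫ mulGen V ≫ h = incl V (n + 1) ≫ h := by
  rw [← Category.assoc, incl_mulGen]

/-- The iterated right multiplication `(∐ n, V^{⊗ n}) ⊗ V^{⊗ m} ⟶ ∐ n, V^{⊗ n}`. -/
def mulPow (V : C) : ∀ m : ℕ, tobj V ⊗ tpow V m ⟶ tobj V
  | 0 => (ρ_ (tobj V)).hom
  | m + 1 => (α_ (tobj V) (tpow V m) V).inv ≫ mulPow V m ▷ V ≫ mulGen V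

/-- The multiplication of the tensor algebra. -/
def tmul (V : C) : tobj V ⊗ tobj V ⟶ tobj V :=
  mapDesc (tensorLeft (tobj V)) (mulPow V)

@[simp]
lemma incl_tmul (V : C) (m : ℕ) : tobj V ◁ incl V m ≫ tmul V = mulPow V m :=
  map_incl_mapDesc (tensorLeft (tobj V)) (mulPow V) m

lemma incl_tmul_assoc (V : C) (m : ℕ) {Z : C} (h : tobj V ⟶ Z) :
    tobj V ◁ incl V m ≫ tmul V ≫ h = mulPow V m ≫ h := by
  rw [← Category.assoc, incl_tmul]

/-- The multiplication of the tensor algebra is given by concatenation. -/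
lemma incl_incl_tmul (V : C) (m n : ℕ) :
    (incl V m ⊗ₘ incl V n) ≫ tmul V = concat V m n ≫ incl V (m + n) := by
  rw [MonoidalCategory.tensorHom_def, Category.assoc, incl_tmul]
  induction n with
  | zero => simp [mulPow, concat]
  | succ n ih =>
    have h : (concat V m n ≫ incl V (m + n)) ▷ V ≫ mulGen V =
        concat V m n ▷ V ≫ incl V (m + n + 1) := by
      rw [comp_whiskerRight, Category.assoc, incl_mulGen]
    simp only [mulPow, concat]
    rw [Category.assoc]
    refine Eq.trans ?_ (congrArg (fun k => (α_ (tpow V m) (tpow V n) V).inv ≫ k) h)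
    rw [← ih]
    simp

lemma tmul_mulGen (V : C) :
    tobj V ◁ mulGen V ≫ tmul V = (α_ (tobj V) (tobj V) V).inv ≫ tmul V ▷ V ≫ mulGen V := by
  rw [← cancel_epi (α_ (tobj V) (tobj V) V).hom]
  have : ∀ {Z : C} {f g : (tobj V ⊗ tobj V) ⊗ V ⟶ Z},
      (∀ n, (tobj V ◁ incl V n) ▷ V ≫ f = (tobj V ◁ incl V n) ▷ V ≫ g) → f = g := by
    intro Z f g h
    refine (isColimitOfPreserves (tensorLeft (tobj V) ⋙ tensorRight V)
      (colimit.isColimit (Discrete.functor (tpow V)))).hom_ext ?_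
    rintro ⟨n⟩
    exact h n
  apply this
  intro n
  have h1 := associator_naturality_middle_assoc (tobj V) (incl V n) V (tobj V ◁ mulGen V ≫ tmul V)
  rw [h1, ← MonoidalCategory.whiskerLeft_comp_assoc, incl_mulGen, incl_tmul]
  simp only [mulPow, Iso.hom_inv_id_assoc, ← comp_whiskerRight_assoc, incl_tmul]

lemma tmul_mulPow (V : C) (m : ℕ) :
    (α_ (tobj V) (tobj V) (tpow V m)).hom ≫ tobj V ◁ mulPow V m ≫ tmul V =
      tmul V ▷ tpow V m ≫ mulPow V m := by
  induction m with
  | zero => simp [mulPow]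
  | succ m ih =>
    simp only [mulPow, MonoidalCategory.whiskerLeft_comp, Category.assoc, tmul_mulGen]
    have h : (tobj V ◁ mulPow V m) ▷ V ≫ tmul V ▷ V =
        (α_ (tobj V) (tobj V) (tpow V m)).inv ▷ V ≫ tmul V ▷ tpow V m ▷ V ≫ mulPow V m ▷ V := by
      rw [← comp_whiskerRight, ← comp_whiskerRight, ← comp_whiskerRight, ← ih,
        Iso.inv_hom_id_assoc]
    rw [associator_inv_naturality_middle_assoc, reassoc_of% h]
    simp

instance tobjMonObj (V : C) : MonObj (tobj V) where
  one := incl V 0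
  mul := tmul V
  one_mul := by
    apply whiskerLeft_hom_ext
    intro n
    rw [whisker_exchange_assoc, incl_tmul, leftUnitor_naturality]
    induction n with
    | zero => simp [mulPow, unitors_equal]
    | succ n ih =>
      have h : (incl V 0 ▷ tpow V n ≫ mulPow V n) ▷ V ≫ mulGen V =
          ((λ_ (tpow V n)).hom ≫ incl V n) ▷ V ≫ mulGen V := by rw [ih]
      simp only [comp_whiskerRight, Category.assoc, incl_mulGen] at h
      simp only [mulPow]
      rw [associator_inv_naturality_left_assoc, h]
      simp
  mul_one := by simp [mulPow]
  mul_assoc := by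
    apply whiskerLeft_hom_ext
    intro n
    rw [whisker_exchange_assoc, incl_tmul, ← tmul_mulPow, associator_naturality_right_assoc,
      ← MonoidalCategory.whiskerLeft_comp_assoc, incl_tmul]

/-- The tensor algebra `T V` of `V`, as a monoid. -/
abbrev talg (V : C) : Mon C := Mon.mk (tobj V)

lemma gen_mul (V : C) (n : ℕ) : (incl V n ⊗ₘ gen V) ≫ μ[tobj V] = incl V (n + 1) := by
  change _ ≫ tmul V = _
  have h := incl_incl_tmul V n 1
  have e : (incl V n ⊗ₘ gen V) = tpow V n ◁ (λ_ V).inv ≫ (incl V n ⊗ₘ incl V 1) := by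
    simp [gen, MonoidalCategory.tensorHom_def']
  rw [e, Category.assoc, h]
  simp [concat]

/-- The components of the monoid morphism extending `f`. -/
def liftPow {V : C} {A : C} [MonObj A] (f : V ⟶ A) (n : ℕ) : tpow V n ⟶ A :=
  tpowMap f n ≫ iterMul A n

@[simp]
lemma liftPow_zero {V : C} {A : C} [MonObj A] (f : V ⟶ A) : liftPow f 0 = η[A] := by
  simp [liftPow, tpowMap, iterMul]

@[simp]
lemma liftPow_succ {V : C} {A : C} [MonObj A] (f : V ⟶ A) (n : ℕ) :
    liftPow f (n + 1) = (liftPow f n ⊗ₘ f) ≫ μ[A] := by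
  simp only [liftPow, tpowMap, iterMul]
  rw [MonoidalCategory.tensorHom_def, MonoidalCategory.tensorHom_def, Category.assoc,
    whisker_exchange_assoc, comp_whiskerRight, Category.assoc, Category.assoc]

lemma mulGen_tdesc {V : C} {A : C} [MonObj A] (f : V ⟶ A) :
    mulGen V ≫ tdesc (liftPow f) = (tdesc (liftPow f) ⊗ₘ f) ≫ μ[A] := by
  apply whiskerRight_hom_ext
  intro n
  rw [incl_mulGen_assoc, incl_tdesc, liftPow_succ, MonoidalCategory.tensorHom_def,
    MonoidalCategory.tensorHom_def, Category.assoc, Category.assoc, ← comp_whiskerRight_assoc,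
    incl_tdesc]

lemma mulPow_tdesc {V : C} {A : C} [MonObj A] (f : V ⟶ A) (n : ℕ) :
    mulPow V n ≫ tdesc (liftPow f) = (tdesc (liftPow f) ⊗ₘ liftPow f n) ≫ μ[A] := by
  induction n with
  | zero => simp [mulPow]
  | succ n ih =>
    simp only [mulPow, Category.assoc, mulGen_tdesc, liftPow_succ]
    have e : (tdesc (liftPow f) ⊗ₘ (liftPow f n ⊗ₘ f) ≫ μ[A]) =
        (tdesc (liftPow f) ⊗ₘ (liftPow f n ⊗ₘ f)) ≫ A ◁ μ[A] := by
      simp [MonoidalCategory.tensorHom_def]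
    rw [e, Category.assoc, MonObj.mul_assoc_flip, associator_inv_naturality_assoc,
      MonoidalCategory.tensorHom_def, Category.assoc, ← comp_whiskerRight_assoc, ih]
    simp only [MonoidalCategory.tensorHom_def, comp_whiskerRight, Category.assoc]
    rw [← whisker_exchange_assoc]

/-- The monoid morphism `T V ⟶ A` whose component in degree `n` is
`V^{⊗ n} ⟶ A^{⊗ n} ⟶ A`. -/
def lift {V : C} {A : Mon C} (f : V ⟶ A.X) : talg V ⟶ A :=
  Mon.Hom.mk' (M := talg V) (tdesc (liftPow f))
    ((incl_tdesc _ 0).trans (liftPow_zero f))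
    (by
      change tmul V ≫ _ = _
      apply whiskerLeft_hom_ext
      intro n
      rw [incl_tmul_assoc, mulPow_tdesc]
      rw [MonoidalCategory.tensorHom_def', MonoidalCategory.tensorHom_def', Category.assoc,
        Category.assoc, ← MonoidalCategory.whiskerLeft_comp_assoc, incl_tdesc])

@[simp]
lemma gen_lift {V : C} {A : Mon C} (f : V ⟶ A.X) : gen V ≫ (lift f).hom = f := by
  change gen V ≫ tdesc (liftPow f) = f
  simp [gen]

lemma gen_lift_assoc {V : C} {A : Mon C} (f : V ⟶ A.X) {Z : C} (h : A.X ⟶ Z) :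
    gen V ≫ (lift f).hom ≫ h = f ≫ h :=
  (Category.assoc _ _ _).symm.trans (congrArg (fun k => k ≫ h) (gen_lift f))

lemma talg_hom_ext {V : C} {A : Mon C} {f g : talg V ⟶ A}
    (h : gen V ≫ f.hom = gen V ≫ g.hom) : f = g := by
  apply Mon.Hom.ext
  apply tobj_hom_ext
  intro n
  induction n with
  | zero => exact (IsMonHom.one_hom f.hom).trans (IsMonHom.one_hom g.hom).symm
  | succ n ih =>
    have hf := IsMonHom.mul_hom f.hom
    have hg := IsMonHom.mul_hom g.hom
    rw [← gen_mul, Category.assoc, Category.assoc, hf, hg]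
    simp only [tensorHom_comp_tensorHom_assoc, ih, h]

variable (C) in
/-- The tensor algebra functor `T`, left adjoint to the forgetful functor `Ω`. -/
def T : C ⥤ Mon C where
  obj V := talg V
  map f := lift (f ≫ gen _)
  map_id V := by apply talg_hom_ext; simp
  map_comp f g := by apply talg_hom_ext; simp [gen_lift_assoc]

variable (C) in
/-- The adjunction between the tensor algebra functor `T` and the forgetful functor `Ω`; its unit
is the inclusion of the degree one component. -/
def tensorAdj : T C ⊣ Mon.forget C :=
  Adjunction.mkOfHomEquiv
    { homEquiv := fun V A =>
        { toFun := fun f => gen V ≫ f.hom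
          invFun := fun f => lift f
          left_inv := fun f => talg_hom_ext (gen_lift _)
          right_inv := fun f => gen_lift f }
      homEquiv_naturality_left_symm := fun {V' V A} f g => by
        apply talg_hom_ext
        change gen V' ≫ (lift (f ≫ g)).hom = gen V' ≫ (lift (f ≫ gen V)).hom ≫ (lift g).hom
        rw [gen_lift, gen_lift_assoc, Category.assoc]
        exact congrArg (fun k => f ≫ k) (gen_lift g).symm
      homEquiv_naturality_right := fun {V A A'} f g => (Category.assoc _ _ _).symm }

@[simp]
lemma tensorAdj_unit_app (V : C) : (tensorAdj C).unit.app V = gen V := by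
  simp only [tensorAdj, Adjunction.mkOfHomEquiv_unit_app]
  exact Category.comp_id _

/-- The counit of the adjunction `T ⊣ Ω` is given by the iterated multiplications. -/
lemma incl_tensorAdj_counit (A : Mon C) (n : ℕ) :
    incl A.X n ≫ ((tensorAdj C).counit.app A).hom = iterMul A.X n := by
  have h : ∀ n, tpowMap (𝟙 A.X) n = 𝟙 (tpow A.X n) := by
    intro n
    induction n with
    | zero => rfl
    | succ n ih => simp [tpowMap, ih]
  have h' : (tensorAdj C).counit.app A = lift (𝟙 A.X) := by
    simp only [tensorAdj, Adjunction.mkOfHomEquiv_counit_app]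
    rfl
  rw [h']
  change incl A.X n ≫ tdesc (liftPow (𝟙 A.X)) = _
  rw [incl_tdesc, liftPow, h, Category.id_comp]

lemma incl_T_map {V W : C} (f : V ⟶ W) (n : ℕ) :
    incl V n ≫ ((T C).map f).hom = tpowMap f n ≫ incl W n := by
  change incl V n ≫ tdesc (liftPow (A := tobj W) (f ≫ gen W)) = _
  rw [incl_tdesc]
  induction n with
  | zero => exact (liftPow_zero _).trans (Category.id_comp _).symm
  | succ n ih =>
    rw [liftPow_succ, ih, ← gen_mul, tpowMap, tensorHom_comp_tensorHom_assoc]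

end Multiplication

end Coproducts

/-! ### Primitive elements -/

section Primitives

variable [BraidedCategory C]

/-- The comultiplication of a bialgebra, as a morphism of `C`. -/
def bcomul (B : Bimon C) : B.X.X ⟶ B.X.X ⊗ B.X.X := B.comon.comul.hom

/-- The counit of a bialgebra, as a morphism of `C`. -/
def bcounit (B : Bimon C) : B.X.X ⟶ 𝟙_ C := B.comon.counit.hom

variable [Preadditive C]

/-- The morphism `x ↦ 1 ⊗ x + x ⊗ 1`. -/
def primMap (A : C) [MonObj A] : A ⟶ A ⊗ A :=
  (λ_ A).inv ≫ η[A] ▷ A + (ρ_ A).inv ≫ A ◁ η[A]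

lemma hom_primMap [MonoidalPreadditive C] {A B : C} [MonObj A] [MonObj B] (f : A ⟶ B)
    [IsMonHom f] : f ≫ primMap B = primMap A ≫ (f ⊗ₘ f) := by
  simp only [primMap, Preadditive.comp_add, Preadditive.add_comp, Category.assoc]
  congr 1
  · rw [MonoidalCategory.tensorHom_def, ← comp_whiskerRight_assoc, IsMonHom.one_hom,
      ← whisker_exchange, leftUnitor_inv_naturality_assoc]
  · rw [MonoidalCategory.tensorHom_def', ← MonoidalCategory.whiskerLeft_comp_assoc,
      IsMonHom.one_hom, whisker_exchange, rightUnitor_inv_naturality_assoc]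

section Equalizers
variable [HasEqualizers C]

/-- The object of primitive elements of a bialgebra `B`: the equalizer of the comultiplication
and of `x ↦ 1 ⊗ x + x ⊗ 1`. -/
def primObj (B : Bimon C) : C := equalizer (bcomul B) (primMap B.X.X)

/-- The inclusion of the primitive elements. -/
def primIncl (B : Bimon C) : primObj B ⟶ B.X.X :=
  equalizer.ι (bcomul B) (primMap B.X.X)

lemma primIncl_condition (B : Bimon C) :
    primIncl B ≫ bcomul B = primIncl B ≫ primMap B.X.X :=
  equalizer.condition _ _

lemma primIncl_condition_assoc (B : Bimon C) {Z : C} (h : B.X.X ⊗ B.X.X ⟶ Z) :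
    primIncl B ≫ bcomul B ≫ h = primIncl B ≫ primMap B.X.X ≫ h := by
  rw [← Category.assoc, primIncl_condition, Category.assoc]

instance (B : Bimon C) : Mono (primIncl B) :=
  inferInstanceAs (Mono (equalizer.ι (bcomul B) (primMap B.X.X)))

/-- A morphism into the primitive elements. -/
def primLift {V : C} {B : Bimon C} (f : V ⟶ B.X.X)
    (h : f ≫ bcomul B = f ≫ primMap B.X.X) : V ⟶ primObj B :=
  equalizer.lift f h

@[simp]
lemma primLift_incl {V : C} {B : Bimon C} (f : V ⟶ B.X.X)
    (h : f ≫ bcomul B = f ≫ primMap B.X.X) :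
    primLift f h ≫ primIncl B = f :=
  equalizer.lift_ι f h

variable [MonoidalPreadditive C]

lemma primLift_incl_assoc {V : C} {B : Bimon C} (f : V ⟶ B.X.X)
    (h : f ≫ bcomul B = f ≫ primMap B.X.X) {Z : C} (k : B.X.X ⟶ Z) :
    primLift f h ≫ primIncl B ≫ k = f ≫ k := by
  rw [← Category.assoc, primLift_incl]

lemma prim_hom_aux {V : C} {A B : Bimon C} (g : V ⟶ A.X.X)
    (hg : g ≫ bcomul A = g ≫ primMap A.X.X) (f : A ⟶ B) :
    (g ≫ f.hom.hom) ≫ bcomul B = (g ≫ f.hom.hom) ≫ primMap B.X.X := by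
  have h : f.hom.hom ≫ bcomul B =
      bcomul A ≫ (f.hom.hom ⊗ₘ f.hom.hom) :=
    congrArg Mon.Hom.hom f.isComonHom_hom.hom_comul
  rw [Category.assoc, Category.assoc, h, reassoc_of% hg, hom_primMap]

lemma comp_primIncl_condition {V : C} {B : Bimon C} (f : V ⟶ primObj B) :
    (f ≫ primIncl B) ≫ bcomul B = (f ≫ primIncl B) ≫ primMap B.X.X := by
  rw [Category.assoc, primIncl_condition, Category.assoc]

variable (C) in
/-- The functor `P` of primitive elements. -/
def primFunctor : Bimon C ⥤ C where
  obj B := primObj B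
  map {A B} f := primLift (primIncl A ≫ f.hom.hom) (prim_hom_aux _ (primIncl_condition A) f)
  map_id A := by
    rw [← cancel_mono (primIncl A)]
    simp
  map_comp f g := by
    rw [← cancel_mono (primIncl _)]
    simp [primLift_incl_assoc]

/-- Primitive elements are killed by the counit. -/
lemma primIncl_counit (B : Bimon C) : primIncl B ≫ bcounit B = 0 := by
  have h1 : bcomul B ≫ bcounit B ▷ B.X.X = (λ_ B.X.X).inv :=
    congrArg Mon.Hom.hom B.comon.counit_comul
  have h2 : η[B.X.X] ≫ bcounit B = 𝟙 (𝟙_ C) := IsMonHom.one_hom B.comon.counit.hom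
  have h3 := primIncl_condition_assoc B (bcounit B ▷ B.X.X)
  rw [h1] at h3
  simp only [primMap, Preadditive.add_comp, Preadditive.comp_add, Category.assoc,
    ← comp_whiskerRight, h2] at h3
  rw [whisker_exchange, ← rightUnitor_inv_naturality_assoc] at h3
  have h4 : primIncl B ≫ bcounit B ≫ (ρ_ (𝟙_ C)).inv ≫ 𝟙_ C ◁ η[B.X.X] = 0 := by
    simpa using h3
  have h5 := congrArg (fun k => k ≫ (λ_ B.X.X).hom ≫ bcounit B) h4
  simpa [unitors_equal, h2] using h5

lemma comp_primIncl_counit {V : C} {B : Bimon C} (f : V ⟶ primObj B) :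
    (f ≫ primIncl B) ≫ bcounit B = 0 := by
  rw [Category.assoc, primIncl_counit, comp_zero]

end Equalizers
end Primitives

/-! ### The tensor bialgebra -/

section TensorBialgebra

variable [BraidedCategory C] [Preadditive C] [HasCoproductsOfShape ℕ C]
  [∀ X : C, PreservesColimitsOfShape (Discrete ℕ) (tensorLeft X)]
  [∀ X : C, PreservesColimitsOfShape (Discrete ℕ) (tensorRight X)] [MonoidalPreadditive C]

/-- The projection `∐ n, V^{⊗ n} ⟶ V` onto the component of degree one. -/
def proj (V : C) : tobj V ⟶ V :=
  tdesc fun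
    | 1 => (λ_ V).hom
    | _ => 0

/-- The comultiplication of the tensor bialgebra: the algebra morphism `T V ⟶ T V ⊗ T V`
for which the elements of `V` are primitive. -/
def tcomul (V : C) : talg V ⟶ talg V ⊗ talg V :=
  lift (A := talg V ⊗ talg V) (gen V ≫ primMap (tobj V))

/-- The counit of the tensor bialgebra: the algebra morphism `T V ⟶ 𝟙` vanishing on `V`. -/
def tcounit (V : C) : talg V ⟶ 𝟙_ (Mon C) :=
  lift (A := 𝟙_ (Mon C)) (0 : V ⟶ 𝟙_ C)

lemma gen_tcomul (V : C) :
    gen V ≫ (tcomul V).hom = gen V ≫ primMap (tobj V) := gen_lift _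

lemma gen_tcounit (V : C) :
    gen V ≫ (tcounit V).hom = (0 : V ⟶ 𝟙_ C) := gen_lift _

lemma one_comul_hom {A : Mon C} (f : A ⟶ A ⊗ A) :
    η[A.X] ≫ f.hom = (λ_ (𝟙_ C)).inv ≫ (η[A.X] ⊗ₘ η[A.X]) :=
  IsMonHom.one_hom f.hom

lemma prim_coassoc {V A : C} [MonObj A] {g : V ⟶ A} {c : A ⟶ A ⊗ A}
    (hg : g ≫ c = g ≫ primMap A) (h1 : η[A] ≫ c = (λ_ (𝟙_ C)).inv ≫ (η[A] ⊗ₘ η[A])) :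
    g ≫ c ≫ A ◁ c = g ≫ c ≫ c ▷ A ≫ (α_ A A A).hom := by
  have e1 : g ≫ c ≫ A ◁ c = (λ_ V).inv ≫ 𝟙_ C ◁ (g ≫ c) ≫ η[A] ▷ (A ⊗ A) +
      (ρ_ V).inv ≫ g ▷ 𝟙_ C ≫ A ◁ (η[A] ≫ c) := by
    rw [show g ≫ c ≫ A ◁ c = (g ≫ primMap A) ≫ A ◁ c by rw [← hg, Category.assoc]]
    simp only [primMap, Preadditive.add_comp, Preadditive.comp_add, Category.assoc]
    rw [← whisker_exchange]
    simp
  have e2 : g ≫ c ≫ c ▷ A = (λ_ V).inv ≫ 𝟙_ C ◁ g ≫ (η[A] ≫ c) ▷ A +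
      (ρ_ V).inv ≫ (g ≫ c) ▷ 𝟙_ C ≫ (A ⊗ A) ◁ η[A] := by
    rw [show g ≫ c ≫ c ▷ A = (g ≫ primMap A) ≫ c ▷ A by rw [← hg, Category.assoc]]
    simp only [primMap, Preadditive.add_comp, Preadditive.comp_add, Category.assoc]
    rw [whisker_exchange]
    simp
  have t1 : g ≫ (λ_ A).inv ≫ 𝟙_ C ◁ ((λ_ A).inv ≫ η[A] ▷ A) ≫ η[A] ▷ (A ⊗ A) =
      g ≫ (λ_ A).inv ≫ ((λ_ (𝟙_ C)).inv ≫ (η[A] ⊗ₘ η[A])) ▷ A ≫ (α_ A A A).hom := by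
    rw [MonoidalCategory.whiskerLeft_comp, Category.assoc, whisker_exchange,
      MonoidalCategory.tensorHom_def]
    monoidal
  have t2 : g ≫ (λ_ A).inv ≫ 𝟙_ C ◁ ((ρ_ A).inv ≫ A ◁ η[A]) ≫ η[A] ▷ (A ⊗ A) =
      g ≫ (ρ_ A).inv ≫ ((λ_ A).inv ≫ η[A] ▷ A) ▷ 𝟙_ C ≫ (A ⊗ A) ◁ η[A] ≫ (α_ A A A).hom := by
    rw [MonoidalCategory.whiskerLeft_comp, Category.assoc, whisker_exchange]
    monoidal
  have t3 : g ≫ (ρ_ A).inv ≫ A ◁ ((λ_ (𝟙_ C)).inv ≫ (η[A] ⊗ₘ η[A])) =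
      g ≫ (ρ_ A).inv ≫ ((ρ_ A).inv ≫ A ◁ η[A]) ▷ 𝟙_ C ≫ (A ⊗ A) ◁ η[A] ≫ (α_ A A A).hom := by
    rw [MonoidalCategory.tensorHom_def]
    monoidal
  have e2' := congrArg (fun k => k ≫ (α_ A A A).hom) e2
  simp only [Category.assoc] at e2'
  rw [e1, e2', h1, hg]
  simp only [primMap, MonoidalCategory.whiskerLeft_comp, comp_whiskerRight, Category.assoc,
    Preadditive.comp_add, Preadditive.add_comp, MonoidalPreadditive.whiskerLeft_add,
    MonoidalPreadditive.add_whiskerRight, ← leftUnitor_inv_naturality_assoc,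
    ← rightUnitor_inv_naturality_assoc] at t1 t2 t3 ⊢
  rw [t1, t2, t3, add_assoc]

lemma one_tcomul (V : C) :
    η[tobj V] ≫ (tcomul V).hom = (λ_ (𝟙_ C)).inv ≫ (η[tobj V] ⊗ₘ η[tobj V]) :=
  IsMonHom.one_hom (tcomul V).hom

lemma one_tcounit (V : C) : η[tobj V] ≫ (tcounit V).hom = 𝟙 (𝟙_ C) :=
  IsMonHom.one_hom (tcounit V).hom

instance tensorComon (V : C) : ComonObj (talg V) where
  counit := tcounit V
  comul := tcomul V
  counit_comul := by
    apply talg_hom_ext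
    change gen V ≫ (tcomul V).hom ≫ (tcounit V).hom ▷ tobj V = gen V ≫ (λ_ (tobj V)).inv
    rw [← Category.assoc, gen_tcomul]
    simp only [primMap, Preadditive.add_comp, Preadditive.comp_add, Category.assoc,
      ← comp_whiskerRight, one_tcounit]
    rw [whisker_exchange, rightUnitor_inv_naturality_assoc, ← comp_whiskerRight_assoc,
      gen_tcounit]
    simp
  comul_counit := by
    apply talg_hom_ext
    change gen V ≫ (tcomul V).hom ≫ tobj V ◁ (tcounit V).hom = gen V ≫ (ρ_ (tobj V)).inv
    rw [← Category.assoc, gen_tcomul]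
    simp only [primMap, Preadditive.add_comp, Preadditive.comp_add, Category.assoc,
      ← MonoidalCategory.whiskerLeft_comp, one_tcounit]
    rw [← whisker_exchange, leftUnitor_inv_naturality_assoc,
      ← MonoidalCategory.whiskerLeft_comp_assoc, gen_tcounit]
    simp
  comul_assoc := by
    apply talg_hom_ext
    change gen V ≫ (tcomul V).hom ≫ tobj V ◁ (tcomul V).hom =
      gen V ≫ (tcomul V).hom ≫ (tcomul V).hom ▷ tobj V ≫ (α_ (tobj V) (tobj V) (tobj V)).hom
    exact prim_coassoc (gen_tcomul V) (one_tcomul V)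

/-- The tensor bialgebra of `V`. -/
def tbialg (V : C) : Bimon C := Comon.mk (talg V)

lemma lift_isComonHom {V : C} {B : Bimon C} (f : V ⟶ B.X.X)
    (h : f ≫ bcomul B = f ≫ primMap B.X.X) (h' : f ≫ bcounit B = 0) :
    @IsComonHom (Mon C) _ _ (talg V) B.X (tensorComon V) B.comon (lift f) := by
  let _ : ComonObj B.X := B.comon
  constructor
  · apply talg_hom_ext
    refine Eq.trans ?_ (gen_tcounit V).symm
    exact (gen_lift_assoc f (bcounit B)).trans h'
  · apply talg_hom_ext
    change gen V ≫ (lift f).hom ≫ bcomul B =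
      gen V ≫ (tcomul V).hom ≫ ((lift f).hom ⊗ₘ (lift f).hom)
    rw [gen_lift_assoc, h, ← Category.assoc (gen V), gen_tcomul, Category.assoc, ← hom_primMap,
      gen_lift_assoc]

/-- The bialgebra morphism `T V ⟶ B` extending a morphism from `V` to the primitive elements
of `B`. -/
def blift {V : C} {B : Bimon C} (f : V ⟶ B.X.X)
    (h : f ≫ bcomul B = f ≫ primMap B.X.X) (h' : f ≫ bcounit B = 0) : tbialg V ⟶ B :=
  @Comon.Hom.mk (Mon C) _ _ (tbialg V) B (lift f) (lift_isComonHom f h h')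

variable (C) in
/-- The tensor bialgebra functor. -/
def TB : C ⥤ Bimon C where
  obj V := tbialg V
  map {V W} f := blift (B := tbialg W) (f ≫ gen W)
    (by
      change (f ≫ gen W) ≫ (tcomul W).hom = _
      rw [Category.assoc, gen_tcomul]
      exact (Category.assoc _ _ _).symm)
    (by
      change (f ≫ gen W) ≫ (tcounit W).hom = _
      rw [Category.assoc, gen_tcounit, comp_zero])
  map_id V := Comon.Hom.ext ((T C).map_id V)
  map_comp f g := Comon.Hom.ext ((T C).map_comp f g)

/-- The projections onto the degree one component are natural. -/
lemma T_map_proj {V W : C} (f : V ⟶ W) :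
    ((T C).map f).hom ≫ proj W = proj V ≫ f := by
  apply tobj_hom_ext
  intro n
  refine (Category.assoc _ _ _).symm.trans
    ((congrArg (fun k => k ≫ proj W) (incl_T_map f n)).trans ?_)
  rw [Category.assoc, proj, proj, incl_tdesc, incl_tdesc_assoc]
  match n with
  | 0 => simp
  | 1 => simp [tpowMap]
  | n + 2 => simp

variable (C) in
/-- The natural transformation `ω : Ω T ⟶ Id` of the projections onto degree one. -/
def omega : T C ⋙ Mon.forget C ⟶ 𝟭 C where
  app V := proj V
  naturality _ _ f := T_map_proj f

section Equalizers
variable [HasEqualizers C]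

lemma gen_bcomul (V : C) :
    gen V ≫ bcomul (tbialg V) = gen V ≫ primMap (tbialg V).X.X := gen_tcomul V

lemma blift_condition {V : C} {B : Bimon C} (f : tbialg V ⟶ B) :
    (gen V ≫ f.hom.hom) ≫ bcomul B = (gen V ≫ f.hom.hom) ≫ primMap B.X.X :=
  prim_hom_aux (A := tbialg V) (gen V) (gen_bcomul V) f

/-- Bialgebra morphisms `T V ⟶ B` correspond to morphisms from `V` to the primitive elements
of `B`. -/
def bialgEquiv (V : C) (B : Bimon C) : (tbialg V ⟶ B) ≃ (V ⟶ primObj B) where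
  toFun f := primLift (gen V ≫ f.hom.hom) (blift_condition f)
  invFun f := blift (f ≫ primIncl B) (comp_primIncl_condition f) (comp_primIncl_counit f)
  left_inv f := Comon.Hom.ext (talg_hom_ext ((gen_lift _).trans (primLift_incl _ _)))
  right_inv f := by
    rw [← cancel_mono (primIncl B), primLift_incl]
    exact gen_lift _

lemma bialgEquiv_incl {V : C} {B : Bimon C} (f : tbialg V ⟶ B) :
    bialgEquiv V B f ≫ primIncl B = gen V ≫ f.hom.hom := primLift_incl _ _

lemma gen_bialgEquiv_symm {V : C} {B : Bimon C} (f : V ⟶ primObj B) :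
    gen V ≫ ((bialgEquiv V B).symm f).hom.hom = f ≫ primIncl B := gen_lift _

lemma bialg_hom_ext {V : C} {B : Bimon C} {f g : tbialg V ⟶ B}
    (h : gen V ≫ f.hom.hom = gen V ≫ g.hom.hom) : f = g :=
  Comon.Hom.ext (talg_hom_ext h)

lemma bialgEquiv_symm_naturality {V' V : C} {B : Bimon C} (f : V' ⟶ V) (g : V ⟶ primObj B) :
    (bialgEquiv V' B).symm (f ≫ g) = (TB C).map f ≫ (bialgEquiv V B).symm g := by
  apply bialg_hom_ext
  refine (gen_bialgEquiv_symm _).trans ?_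
  refine Eq.trans ?_ (gen_lift_assoc (A := talg V) (f ≫ gen V) _).symm
  refine (Category.assoc f g (primIncl B)).trans ?_
  refine Eq.trans ?_ (Category.assoc f (gen V) _).symm
  exact congrArg (fun k => f ≫ k) (gen_bialgEquiv_symm g).symm

lemma bialgEquiv_naturality {V : C} {A B : Bimon C} (f : tbialg V ⟶ A) (g : A ⟶ B) :
    bialgEquiv V B (f ≫ g) = bialgEquiv V A f ≫ (primFunctor C).map g := by
  have h : bialgEquiv V B (f ≫ g) =
      bialgEquiv V A f ≫ primLift (primIncl A ≫ g.hom.hom)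
        (prim_hom_aux _ (primIncl_condition A) g) := by
    rw [← cancel_mono (primIncl B), bialgEquiv_incl, Category.assoc, primLift_incl,
      ← Category.assoc, bialgEquiv_incl]
    exact (Category.assoc _ _ _).symm
  exact h

variable (C) in
/-- The adjunction between the tensor bialgebra functor and the functor of primitive elements. -/
def bialgAdj : TB C ⊣ primFunctor C :=
  Adjunction.mkOfHomEquiv
    { homEquiv := fun V B => bialgEquiv V B
      homEquiv_naturality_left_symm := fun f g => bialgEquiv_symm_naturality f g
      homEquiv_naturality_right := fun f g => bialgEquiv_naturality f g }

/-- The morphism `gen (P B) ≫ ε B` is the inclusion of the primitive elements. -/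
lemma gen_bialgAdj_counit (B : Bimon C) :
    gen (primObj B) ≫ ((bialgAdj C).counit.app B).hom.hom = primIncl B := by
  have h : (bialgAdj C).counit.app B = (bialgEquiv (primObj B) B).symm (𝟙 (primObj B)) := by
    simp only [bialgAdj, Adjunction.mkOfHomEquiv_counit_app]
    rfl
  rw [h]
  exact (gen_bialgEquiv_symm _).trans (Category.id_comp _)

variable (C) in
/-- The natural transformation `ξ : P ⟶ Ω ℧`, the composite of `η P : P ⟶ Ω T P` and
`Ω ℧ ε : Ω T P = Ω ℧ T P ⟶ Ω ℧`, where `η` is the unit of `T ⊣ Ω` and `ε` is the counit of the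
adjunction between the tensor bialgebra and primitive elements functors. -/
def xi : primFunctor C ⟶ Bimon.toMon C ⋙ Mon.forget C :=
  Functor.whiskerLeft (primFunctor C) (tensorAdj C).unit ≫
    Functor.whiskerRight (bialgAdj C).counit (Bimon.toMon C ⋙ Mon.forget C)

/-- The components of `ξ` are the inclusions of the primitive elements. -/
lemma xi_app (B : Bimon C) : (xi C).app B = primIncl B := by
  refine Eq.trans ?_ (gen_bialgAdj_counit B)
  change (tensorAdj C).unit.app _ ≫ _ = _
  rw [tensorAdj_unit_app]
  rfl

variable (C) in
/-- The natural transformation `γ = ω ∘ ξ T : P T ⟶ Id`. -/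
def gamma : TB C ⋙ primFunctor C ⟶ 𝟭 C :=
  Functor.whiskerLeft (TB C) (xi C) ≫ omega C

lemma TB_toMon : TB C ⋙ Bimon.toMon C = T C := rfl

end Equalizers

end TensorBialgebra
end HSep

end

namespace HSep

/-! ### The degree one projection as a derivation along the counit. -/

section TensorBialgebra

variable {C : Type u} [Category.{v} C] [MonoidalCategory C] [BraidedCategory C] [Preadditive C]
  [MonoidalPreadditive C] [HasCoproductsOfShape ℕ C]
  [∀ X : C, PreservesColimitsOfShape (Discrete ℕ) (tensorLeft X)]
  [∀ X : C, PreservesColimitsOfShape (Discrete ℕ) (tensorRight X)]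

/-! Everything rests on the fact that the projection ω : TV → V is a derivation along the counit ε:
ω(xy) = ε(x)ω(y) + ω(x)ε(y) (`tmul_proj`). Hence ω kills products of two elements of the
augmentation ideal, and it kills 1.

Let φ : TV → TW be an algebra morphism with εφ = ε. It sends 1 to 1, and an element of degree at
least 2 to a sum of products of elements of the augmentation ideal; so ωφ vanishes outside degree
one, that is, ωφ = (ωφη)ω with η the inclusion of the generators (`augmented_hom_proj`, and
`toHom_proj` for bialgebra morphisms).

Put P(f) = ωfη. The factorization of ωg gives ωgfη = (ωgη)(ωfη), so P is multiplicative, while ωη =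
Id makes it a retraction. Since ξ is the inclusion of the primitive elements, γ is ω restricted to
them. The same factorization, applied to the adjunction counit e : TPTV → TV, whose restriction to
generators is that inclusion, gives the identity for γγ. -/

lemma gen_proj (V : C) : gen V ≫ proj V = 𝟙 V := by
  simp [gen, proj]

lemma one_proj (V : C) : η[tobj V] ≫ proj V = 0 := incl_tdesc _ 0

lemma incl_zero_tcounit (V : C) : incl V 0 ≫ (tcounit V).hom = 𝟙 (𝟙_ C) := one_tcounit V

/-- The counit of the tensor bialgebra vanishes in positive degrees. -/
lemma incl_succ_tcounit (V : C) (n : ℕ) : incl V (n + 1) ≫ (tcounit V).hom = 0 := by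
  change incl V (n + 1) ≫ tdesc (liftPow (A := 𝟙_ C) (0 : V ⟶ 𝟙_ C)) = 0
  -- In degree n + 1 the extension of the zero morphism is a product whose last factor is zero.
  rw [incl_tdesc, liftPow_succ, MonoidalCategory.tensorHom_def]
  simp

/-- The degree one component of a product with a generator. -/
lemma mulGen_proj (V : C) : mulGen V ≫ proj V = (tcounit V).hom ▷ V ≫ (λ_ V).hom := by
  apply whiskerRight_hom_ext
  intro n
  rw [incl_mulGen_assoc, ← comp_whiskerRight_assoc, proj, incl_tdesc]
  -- Multiplying by a generator raises the degree by one, so degree one is reached only from degree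
  -- 0, the only degree where the counit is nonzero.
  cases n with
  | zero =>
    refine Eq.trans ?_ (congrArg (fun k => k ▷ V ≫ (λ_ V).hom) (incl_zero_tcounit V)).symm
    simp
  | succ n =>
    refine Eq.trans ?_ (congrArg (fun k => k ▷ V ≫ (λ_ V).hom) (incl_succ_tcounit V n)).symm
    simp

lemma tmul_tcounit (V : C) :
    tmul V ≫ (tcounit V).hom = ((tcounit V).hom ⊗ₘ (tcounit V).hom) ≫ (λ_ (𝟙_ C)).hom :=
  IsMonHom.mul_hom (tcounit V).hom

/-- The projection onto degree one is a derivation along the counit, for elements in positive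
degrees of the right factor. -/
lemma mulPow_succ_proj (V : C) (n : ℕ) :
    mulPow V (n + 1) ≫ proj V =
      (tcounit V).hom ▷ tpow V (n + 1) ≫ (λ_ _).hom ≫ incl V (n + 1) ≫ proj V := by
  -- No induction is needed: splitting off the last generator turns ω into ε of the remaining
  -- product (`mulGen_proj`), and ε is multiplicative.
  have h : mulPow V n ≫ (tcounit V).hom =
      (tcounit V).hom ▷ tpow V n ≫ (λ_ (tpow V n)).hom ≫ incl V n ≫ (tcounit V).hom := by
    rw [← incl_tmul, Category.assoc, tmul_tcounit, MonoidalCategory.tensorHom_def,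
      Category.assoc, whisker_exchange_assoc, ← MonoidalCategory.whiskerLeft_comp_assoc]
    exact congrArg (fun k => (tcounit V).hom ▷ tpow V n ≫ k)
      (leftUnitor_naturality (incl V n ≫ (tcounit V).hom))
  have h' := congrArg (fun k => k ▷ V ≫ (λ_ V).hom) h
  simp only [mulPow, Category.assoc, mulGen_proj]
  -- On the right-hand side too, the inclusion in degree n + 1 is split as a degree n element times
  -- a generator.
  rw [← incl_mulGen_assoc, mulGen_proj]
  simp only [comp_whiskerRight, Category.assoc] at h' ⊢
  rw [h']
  simp

/-- The projection onto degree one is a derivation along the counit. -/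
lemma tmul_proj (V : C) :
    tmul V ≫ proj V = ((tcounit V).hom ⊗ₘ proj V) ≫ (λ_ V).hom +
      (proj V ⊗ₘ (tcounit V).hom) ≫ (ρ_ V).hom := by
  apply whiskerLeft_hom_ext
  intro n
  rw [incl_tmul_assoc, Preadditive.comp_add, MonoidalCategory.tensorHom_def,
    MonoidalCategory.tensorHom_def', Category.assoc, Category.assoc, whisker_exchange_assoc,
    ← MonoidalCategory.whiskerLeft_comp_assoc, ← MonoidalCategory.whiskerLeft_comp_assoc]
  -- Each degree of the right factor keeps one summand: in degree 0 it is a scalar, killed by ω; in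
  -- positive degrees it is killed by ε.
  cases n with
  | zero =>
    rw [incl_zero_tcounit, show incl V 0 ≫ proj V = 0 from one_proj V]
    simp [mulPow]
  | succ n =>
    rw [incl_succ_tcounit, mulPow_succ_proj]
    simp

/-- A product of two elements killed by the counit has no component of degree one. -/
lemma mul_proj_eq_zero {V X Y : C} {x : X ⟶ tobj V} {y : Y ⟶ tobj V}
    (hx : x ≫ (tcounit V).hom = 0) (hy : y ≫ (tcounit V).hom = 0) :
    (x ⊗ₘ y) ≫ tmul V ≫ proj V = 0 := by
  rw [tmul_proj, Preadditive.comp_add, tensorHom_comp_tensorHom_assoc,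
    tensorHom_comp_tensorHom_assoc, hx, hy]
  simp [MonoidalCategory.tensorHom_def]

/-! ### Degree one components of morphisms between tensor algebras. -/

/-- The degree one component of an augmented algebra morphism between tensor algebras factors
through the projection onto degree one. -/
lemma augmented_hom_proj {V W : C} (φ : talg V ⟶ talg W)
    (h : φ.hom ≫ (tcounit W).hom = (tcounit V).hom) :
    φ.hom ≫ proj W = proj V ≫ gen V ≫ φ.hom ≫ proj W := by
  apply tobj_hom_ext
  intro n
  match n with
  | 0 =>
    have h0 : incl V 0 ≫ φ.hom = η[tobj W] := IsMonHom.one_hom φ.hom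
    rw [reassoc_of% h0, one_proj, ← Category.assoc (incl V 0),
      show incl V 0 ≫ proj V = 0 from one_proj V, zero_comp]
  | 1 => simp [proj, gen]
  -- Written as (n + 1) + 1, this degree consists of products of a degree n + 1 element by a
  -- generator. Both factors have positive degree, so ε kills them and their images.
  | n + 2 =>
    have hz : incl V (n + 2) ≫ proj V = 0 := incl_tdesc _ (n + 2)
    have hm : μ[tobj V] ≫ φ.hom = (φ.hom ⊗ₘ φ.hom) ≫ tmul W := IsMonHom.mul_hom φ.hom
    rw [← Category.assoc _ (proj V), hz, zero_comp, ← gen_mul, Category.assoc, reassoc_of% hm,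
      tensorHom_comp_tensorHom_assoc]
    apply mul_proj_eq_zero
    · rw [Category.assoc, h, incl_succ_tcounit]
    · rw [Category.assoc, h, gen_tcounit]

/-- The morphism of `C` underlying a bialgebra morphism between tensor bialgebras. -/
def toHom {V W : C} (φ : tbialg V ⟶ tbialg W) : tobj V ⟶ tobj W := φ.hom.hom

lemma toHom_comp {U V W : C} (φ : tbialg U ⟶ tbialg V) (ψ : tbialg V ⟶ tbialg W) :
    toHom (φ ≫ ψ) = toHom φ ≫ toHom ψ := rfl

/-- The degree one component of a bialgebra morphism between tensor bialgebras factors through the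
projection onto degree one. -/
lemma toHom_proj {V W : C} (φ : tbialg V ⟶ tbialg W) :
    toHom φ ≫ proj W = proj V ≫ gen V ≫ toHom φ ≫ proj W :=
  -- Of the coalgebra structure only the counit enters.
  augmented_hom_proj φ.hom (congrArg Mon.Hom.hom φ.isComonHom_hom.hom_counit)

lemma gen_TB_map {V W : C} (f : V ⟶ W) : gen V ≫ toHom ((TB C).map f) = f ≫ gen W :=
  gen_lift (A := talg W) (f ≫ gen W)

lemma TB_map_proj {V W : C} (f : V ⟶ W) : toHom ((TB C).map f) ≫ proj W = proj V ≫ f :=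
  T_map_proj f

/-! ### Heavy separability. -/

variable (C) in
/-- The tensor bialgebra functor is heavily separable: a bialgebra morphism is sent to its
component from degree one to degree one. -/
theorem TB_isHSeparable : IsHSeparable (TB C) := by
  -- This is γ applied to the adjunct X → PTY of f, because that adjunct followed by the inclusion
  -- of primitives is f restricted to generators.
  refine ⟨fun X Y f => gen X ≫ toHom (V := X) (W := Y) f ≫ proj Y, ?_, ?_, ?_⟩
  · intro X' X Y Y' f (g : tbialg X ⟶ tbialg Y) h
    change gen X' ≫ (toHom ((TB C).map f) ≫ toHom g ≫ toHom ((TB C).map h)) ≫ proj Y' =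
      f ≫ (gen X ≫ toHom g ≫ proj Y) ≫ h
    simp only [Category.assoc]
    rw [TB_map_proj, reassoc_of% gen_TB_map f]
  · intro X Y f
    change gen X ≫ toHom ((TB C).map f) ≫ proj Y = f
    rw [TB_map_proj, reassoc_of% gen_proj X]
  · intro X Y Z (f : tbialg X ⟶ tbialg Y) (g : tbialg Y ⟶ tbialg Z)
    change gen X ≫ toHom (f ≫ g) ≫ proj Z =
      (gen X ≫ toHom f ≫ proj Y) ≫ gen Y ≫ toHom g ≫ proj Z
    simp only [Category.assoc]
    -- The detour Y-projection then Y-inclusion in the middle is absorbed, since ωg only sees degree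
    -- one.
    rw [toHom_comp, Category.assoc, ← toHom_proj g]

/-! ### The two identities for γ. -/

section Equalizers

variable [HasEqualizers C]

/-- The inclusion of the primitive elements of the tensor bialgebra. -/
noncomputable def tprimIncl (V : C) : primObj (tbialg V) ⟶ tobj V := primIncl (tbialg V)

lemma gamma_app (V : C) : (gamma C).app V = tprimIncl V ≫ proj V :=
  congrArg (fun k : primObj (tbialg V) ⟶ tobj V => k ≫ proj V) (xi_app (tbialg V))

lemma bialgAdj_unit_tprimIncl (V : C) :
    (bialgAdj C).unit.app V ≫ tprimIncl V = gen V := by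
  -- The unit is the adjunct of the identity, hence the generators regarded as primitive elements.
  have h : (bialgAdj C).unit.app V = bialgEquiv V (tbialg V) (𝟙 (tbialg V)) := by
    simp only [bialgAdj, Adjunction.mkOfHomEquiv_unit_app]
    rfl
  rw [h]
  exact (bialgEquiv_incl _).trans (Category.comp_id _)

lemma primFunctor_map_tprimIncl {V W : C} (f : tbialg V ⟶ tbialg W) :
    (primFunctor C).map f ≫ tprimIncl W = tprimIncl V ≫ toHom f :=
  primLift_incl _ _

lemma gen_bialgAdj_counit_tbialg (V : C) :
    gen (primObj (tbialg V)) ≫ toHom (V := primObj (tbialg V))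
      ((bialgAdj C).counit.app (tbialg V)) = tprimIncl V :=
  gen_bialgAdj_counit (tbialg V)

variable (C) in
lemma unit_gamma : (bialgAdj C).unit ≫ gamma C = 𝟙 (𝟭 C) := by
  ext V
  change (bialgAdj C).unit.app V ≫ (gamma C).app V = 𝟙 V
  rw [gamma_app]
  refine (Category.assoc _ _ _).symm.trans ?_
  exact (congrArg (fun k => k ≫ proj V) (bialgAdj_unit_tprimIncl V)).trans (gen_proj V)

variable (C) in
-- By naturality of the inclusion of primitives, the right-hand side is ωe restricted to the
-- primitives of TPTV. Factoring ωe through degree one, where e is the inclusion of PTV in TV,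
-- produces the two successive copies of γ.
lemma gamma_hcomp_gamma : gamma C ◫ gamma C =
    Functor.whiskerRight (Functor.whiskerLeft (TB C) (bialgAdj C).counit) (primFunctor C) ≫
      gamma C := by
  ext V
  let e : tbialg (primObj (tbialg V)) ⟶ tbialg V := (bialgAdj C).counit.app (tbialg V)
  change (gamma C).app (primObj (tbialg V)) ≫ (gamma C).app V =
    (primFunctor C).map e ≫ (gamma C).app V
  have key : (tprimIncl (primObj (tbialg V)) ≫ proj (primObj (tbialg V))) ≫
      tprimIncl V ≫ proj V = (primFunctor C).map e ≫ tprimIncl V ≫ proj V := by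
    refine Eq.trans ?_ ((congrArg (fun k => k ≫ proj V)
      (primFunctor_map_tprimIncl e).symm).trans (Category.assoc _ _ _))
    rw [Category.assoc, Category.assoc, toHom_proj e,
      reassoc_of% gen_bialgAdj_counit_tbialg V]
  rw [gamma_app, gamma_app]
  exact key

end Equalizers

end TensorBialgebra

end HSep

theorem mainTheorem2 {C : Type u} [Category.{v} C] [MonoidalCategory C] [BraidedCategory C]
    [Preadditive C] [MonoidalPreadditive C] [HasEqualizers C] [HasCoproductsOfShape ℕ C]
    [∀ X : C, PreservesColimitsOfShape (Discrete ℕ) (tensorLeft X)]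
    [∀ X : C, PreservesColimitsOfShape (Discrete ℕ) (tensorRight X)]
    [∀ X : C, PreservesLimitsOfShape WalkingParallelPair (tensorLeft X)]
    [∀ X : C, PreservesLimitsOfShape WalkingParallelPair (tensorRight X)] :
    (HSep.bialgAdj C).unit ≫ HSep.gamma C = 𝟙 (𝟭 C) ∧
    HSep.gamma C ◫ HSep.gamma C =
      Functor.whiskerRight (Functor.whiskerLeft (HSep.TB C) (HSep.bialgAdj C).counit)
        (HSep.primFunctor C) ≫ HSep.gamma C ∧
    HSep.IsHSeparable (HSep.TB C) :=
  ⟨HSep.unit_gamma C, HSep.gamma_hcomp_gamma C, HSep.TB_isHSeparable C⟩
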